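/- Let $k\ge 2$ and $m\ge 0$ be integers, $\ell=2^m$ and $n=2^{km}$; all logarithms are to base $2$. For a finite probability distribution $p$ let $H(p)=-\sum_x p_x\log p_x$, and for $v\in\mathbb C^n$ let $H_2(v)=H(|v_1|^2,\dots,|v_n|^2)$. A complex $N\times N$ matrix is called Hadamard if it is unitary and all its entries have modulus $1/\sqrt N$. Let $A_0,\dots,A_{k-1}$ be unitary $\ell\times\ell$ matrices such that $A_i^\dagger A_j$ is Hadamard for all $i\ne j$, and put $$C_i=A_i\otimes A_{i+1}\otimes\cdots\otimes A_{k-1}\otimes A_0\otimes\cdots\otimes A_{i-1}\qquad(0\le i\le k-1).$$ A vendor holds a database $d=d_0d_1\cdots d_{k-1}$ of $k$ items of $m$ bits each, uniformly distributed over its $n$ possible values. The vendor picks $i\in\{0,\dots,k-1\}$ uniformly at random and sends the state that is column $d$ of $E_i=C_iP_i$, where $P_i$ is the permutation matrix that maps the basis vector $d_0\cdots d_{k-1}$ to the basis vector $d_id_{i+1}\cdots d_{k-1}d_0\cdots d_{i-1}$. The user, who does not know $i$, measures this state and is told $i$ afterwards. The measurement is either projective, given by a unitary $n\times n$ matrix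 $M$, with outcome $j$ having probability $P(j\mid d,i)=|(ME_i)_{jd}|^2$, or it is a POVM, given by $n\times n$ matrices $R_1,\dots,R_N$ with $\sum_jR_j^\dagger R_j=I$, with $P(j\mid d,i)=(E_i^\dagger R_j^\dagger R_jE_i)_{dd}$. Let $P(\cdot\mid j,i)$ be the posterior distribution of $d$ given $j$ and $i$ by Bayes' theorem. Then: 1. For every unit vector $u\in\mathbb C^n$, $$\sum_{i=0}^{k-1}H_2(C_i^\dagger u)\ \ge\ \frac k2\log n .$$ 2. For every projective measurement and every POVM, and for every outcome $j$ (of a POVM: with $R_j\neq0$), the information that the user gains from $j$, averaged over the choice of encoding, satisfies $$\log n-\frac1k\sum_{i=0}^{k-1}H\bigl(P(\cdot\mid j,i)\bigr)\ \le\ \frac12\log n=\frac{km}2 .$$ Consequently the expected information gain of the user, averaged over both the choice of encoding and the outcome of the measurement, $\frac1k\sum_i\sum_jP(j\mid i)\bigl(\log n-H(P(\cdot\mid j,i))\bigr)$, is at most $\frac12\log n=\frac{km}{2}$ bits as well. -/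

import Mathlib

open scoped Matrix

namespace QuantumDatabase

noncomputable section

/-- A configuration of a database with `k` items of `m` bits each; the value of an item is one of
`2 ^ m` possible values, so there are `n = 2 ^ (k * m)` configurations. -/
abbrev Database (k m : ℕ) : Type := Fin k → Fin (2 ^ m)

/-- Shannon entropy, in bits, of a finite distribution: `H(p) = - ∑ p_x log₂ p_x`. -/
def entropy {ι : Type*} [Fintype ι] (p : ι → ℝ) : ℝ :=
  -∑ x, p x * Real.logb 2 (p x)

/-- `H₂(v)`: the entropy of the squared moduli of the coordinates of a complex vector. -/
def entropyTwo {ι : Type*} [Fintype ι] (v : ι → ℂ) : ℝ :=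
  entropy fun x => ‖v x‖ ^ 2

/-- A (complex, normalized) Hadamard matrix: unitary, with all entries of modulus `1 / √N`, where
`N` is the size of the matrix. -/
def IsHadamard {ι : Type*} [Fintype ι] [DecidableEq ι] (W : Matrix ι ι ℂ) : Prop :=
  W ∈ Matrix.unitaryGroup ι ℂ ∧ ∀ x y, ‖W x y‖ = 1 / Real.sqrt (Fintype.card ι)

/-- The tensor (Kronecker) product `B 0 ⊗ B 1 ⊗ ⋯ ⊗ B (k - 1)`. Its rows and columns are indexed
by `k`-tuples. -/
def tensor {ι : Type*} {k : ℕ} (B : Fin k → Matrix ι ι ℂ) :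
    Matrix (Fin k → ι) (Fin k → ι) ℂ :=
  Matrix.of fun x y => ∏ t, B t (x t) (y t)

/-- `C_i = A_i ⊗ A_{i+1} ⊗ ⋯ ⊗ A_{k-1} ⊗ A_0 ⊗ ⋯ ⊗ A_{i-1}`. Addition in `Fin k` is modulo `k`. -/
def cyclicTensor {k m : ℕ} (A : Fin k → Matrix (Fin (2 ^ m)) (Fin (2 ^ m)) ℂ) (i : Fin k) :
    Matrix (Database k m) (Database k m) ℂ :=
  tensor fun t => A (i + t)

/-- The reordering `d_0 ⋯ d_{k-1} ↦ d_i d_{i+1} ⋯ d_{k-1} d_0 ⋯ d_{i-1}` of the items. -/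
def reorder {k m : ℕ} (i : Fin k) (d : Database k m) : Database k m :=
  fun t => d (i + t)

/-- The matrix `P_i` that maps the basis vector `d` to the basis vector `reorder i d`. -/
def reorderMatrix (k m : ℕ) (i : Fin k) : Matrix (Database k m) (Database k m) ℂ :=
  Matrix.of fun c d => if c = reorder i d then 1 else 0

/-- The vendor's `i`-th encoding matrix `E_i = C_i P_i`: the state that is sent when the database
is in configuration `d` is column `d` of `E_i`. -/
def encoding {k m : ℕ} (A : Fin k → Matrix (Fin (2 ^ m)) (Fin (2 ^ m)) ℂ) (i : Fin k) :
    Matrix (Database k m) (Database k m) ℂ :=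
  cyclicTensor A i * reorderMatrix k m i

/-- The uniform prior distribution on the configurations of the database. -/
def prior (k m : ℕ) : Database k m → ℝ :=
  fun _ => 1 / (Fintype.card (Database k m) : ℝ)

/-- A generalized measurement (POVM) with outcomes `j : J`, given by operators `R j` with
`∑ j, (R j)† (R j) = 1`; no further condition is put on the `R j`. -/
def IsPOVM {ι J : Type*} [Fintype ι] [DecidableEq ι] [Fintype J] (R : J → Matrix ι ι ℂ) : Prop :=
  ∑ j, (R j)ᴴ * R j = 1

/-- For a POVM `R`: the probability `P(j | d, i) = (E_i† R_j† R_j E_i)_{dd}` of outcome `j`, given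
that the vendor uses encoding `i` and that the database is in configuration `d`. -/
def povmProb {k m : ℕ} {J : Type*} (A : Fin k → Matrix (Fin (2 ^ m)) (Fin (2 ^ m)) ℂ)
    (R : J → Matrix (Database k m) (Database k m) ℂ) (i : Fin k) (d : Database k m) (j : J) : ℝ :=
  (((encoding A i)ᴴ * (R j)ᴴ * R j * encoding A i) d d).re

/-- For the projective measurement with unitary matrix `M`: the probability
`P(j | d, i) = |(M E_i)_{jd}|²`. -/
def projProb {k m : ℕ} (A : Fin k → Matrix (Fin (2 ^ m)) (Fin (2 ^ m)) ℂ)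
    (M : Matrix (Database k m) (Database k m) ℂ) (i : Fin k) (d j : Database k m) : ℝ :=
  ‖(M * encoding A i) j d‖ ^ 2

section Inference

/-! Inference of the user from the outcome probabilities `L i d j = P(j | d, i)`. -/

variable {k m : ℕ} {J : Type*} (L : Fin k → Database k m → J → ℝ)

/-- `P(j | i)`: the probability of outcome `j` given encoding `i`, for the uniform prior. -/
def outcomeProb (i : Fin k) (j : J) : ℝ :=
  ∑ d, L i d j * prior k m d

/-- `P(d | j, i)`: the posterior distribution on the database given by Bayes' theorem, after
outcome `j` and the announcement of encoding `i`. -/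
def posterior (i : Fin k) (j : J) (d : Database k m) : ℝ :=
  L i d j * prior k m d / outcomeProb L i j

/-- Information gained from outcome `j`, in bits: the reduction in entropy from the prior to the
posterior distribution, averaged over the `k` equally likely encodings. -/
def infoGain (j : J) : ℝ :=
  entropy (prior k m) - (1 / (k : ℝ)) * ∑ i, entropy (posterior L i j)

/-- Expected information gain, in bits: the mean reduction in entropy over the `k` equally likely
encodings and over the outcomes of the measurement. -/
def expectedInfoGain [Fintype J] : ℝ :=
  (1 / (k : ℝ)) * ∑ i, ∑ j,
    outcomeProb L i j * (entropy (prior k m) - entropy (posterior L i j))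

end Inference

end

end QuantumDatabase

/-! Everything rests on the Maassen–Uffink relation (`sum_sq_mul_log_add_le`): if `W` is unitary
with entries of modulus at most `c`, the entropies of `a` and `W *ᵥ a` add up to at least `-2 log
c`. It follows by differentiating a three-lines bound at an endpoint. For `i ≠ j` the matrix `C_i†
C_j` is a tensor product of Hadamard matrices, hence Hadamard, so the entropies of `C_i† u` and
`C_j† u` add up to at least `log n`. Summing over cyclically adjacent pairs counts every `i` twice
and gives part 1. For part 2, the posterior after outcome `j` is, up to reordering the items, a
mixture over the rows of `R j` of the distributions belonging to unit vectors `u`; concavity of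
entropy carries part 1 over to it. The probability of `j` does not depend on `i`, so the expected
gain is an average of the gains per outcome. A projective measurement is a POVM with one nonzero row
per operator. -/

open Complex Complex.HadamardThreeLines in
/-- If `F` is entire, bounded on the strip `0 ≤ re z ≤ 1`, bounded by `1` on the left edge and by
`c` on the right edge, and `F 0 = 1`, then `re F' 0 ≤ log c`. -/
theorem re_deriv_le_log_of_threeLines {F : ℂ → ℂ} {F' : ℂ} {c : ℝ} (hc : 0 < c)
    (hF : Differentiable ℂ F) (hB : BddAbove ((norm ∘ F) '' verticalClosedStrip 0 1))
    (h0 : ∀ z ∈ re ⁻¹' {0}, ‖F z‖ ≤ 1) (h1 : ∀ z ∈ re ⁻¹' {1}, ‖F z‖ ≤ c)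
    (hF0 : F 0 = 1) (hF' : HasDerivAt F F' 0) : F'.re ≤ Real.log c := by
  -- Three lines gives `‖F t‖ ≤ c ^ t`. Both `F t` and `c ^ t` equal 1 at `t = 0`, so their right
  -- slopes there compare.
  have key : ∀ t ∈ Set.Ioo (0 : ℝ) 1, (F t).re ≤ Real.exp (t * Real.log c) := by
    intro t ht
    have h := norm_le_interp_of_mem_verticalClosedStrip₀₁' F (z := (t : ℂ)) (a := 1) (b := c)
      (by simpa [verticalClosedStrip] using ⟨ht.1.le, ht.2.le⟩) hF.diffContOnCl hB h0 h1
    rw [Real.one_rpow, one_mul, ofReal_re, Real.rpow_def_of_pos hc, mul_comm] at h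
    exact (re_le_norm _).trans h
  have hre : HasDerivAt (fun t : ℝ => (F t).re) F'.re 0 :=
    HasDerivAt.real_of_complex (by simpa using hF')
  have hexp : HasDerivAt (fun t : ℝ => Real.exp (t * Real.log c)) (Real.log c) 0 := by
    simpa using ((hasDerivAt_id (0 : ℝ)).mul_const (Real.log c)).exp
  have s1 := (hasDerivWithinAt_iff_tendsto_slope' (s := Set.Ioi (0 : ℝ)) (by simp)).1
    hre.hasDerivWithinAt
  have s2 := (hasDerivWithinAt_iff_tendsto_slope' (s := Set.Ioi (0 : ℝ)) (by simp)).1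
    hexp.hasDerivWithinAt
  refine le_of_tendsto_of_tendsto s1 s2 ?_
  filter_upwards [Ioo_mem_nhdsGT (zero_lt_one (α := ℝ))] with t ht
  have := key t ht
  simp only [slope_def_field, ofReal_zero, hF0, one_re, zero_mul, Real.exp_zero, sub_zero]
  exact div_le_div_of_nonneg_right (by linarith) ht.1.le

/-- A unitary matrix preserves the sum of the squared moduli of the coordinates. -/
theorem sum_sq_norm_mulVec_of_conjTranspose_mul {ι : Type*} [Fintype ι] [DecidableEq ι]
    {U : Matrix ι ι ℂ} (hU : Uᴴ * U = 1) (v : ι → ℂ) :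
    ∑ x, ‖(U *ᵥ v) x‖ ^ 2 = ∑ x, ‖v x‖ ^ 2 := by
  have h (w : ι → ℂ) : ((∑ x, ‖w x‖ ^ 2 : ℝ) : ℂ) = star w ⬝ᵥ w := by
    simp [dotProduct, Complex.conj_mul']
  rw [← Complex.ofReal_inj, h, h, Matrix.star_mulVec, ← Matrix.dotProduct_mulVec,
    Matrix.mulVec_mulVec, hU, Matrix.one_mulVec]

/-- The vector with coordinates `v x * |v x| ^ z`. -/
noncomputable def powTwist {ι : Type*} (v : ι → ℂ) (z : ℂ) (x : ι) : ℂ :=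
  v x * Complex.exp (z * (Real.log ‖v x‖ : ℝ))

theorem norm_powTwist {ι : Type*} (v : ι → ℂ) (z : ℂ) (x : ι) :
    ‖powTwist v z x‖ = ‖v x‖ * Real.exp (z.re * Real.log ‖v x‖) := by
  simp [powTwist, Complex.norm_exp]

theorem norm_powTwist_of_re_eq_zero {ι : Type*} (v : ι → ℂ) {z : ℂ} (hz : z.re = 0) (x : ι) :
    ‖powTwist v z x‖ = ‖v x‖ := by
  simp [norm_powTwist, hz]

theorem norm_powTwist_of_re_eq_one {ι : Type*} (v : ι → ℂ) {z : ℂ} (hz : z.re = 1) (x : ι) :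
    ‖powTwist v z x‖ = ‖v x‖ ^ 2 := by
  rw [norm_powTwist, hz, one_mul]
  -- At a zero coordinate `Real.log 0 = 0`, and the prefactor makes the twist vanish.
  rcases eq_or_ne ‖v x‖ 0 with h | h
  · simp [h]
  · rw [Real.exp_log (lt_of_le_of_ne (norm_nonneg _) h.symm), sq]

theorem norm_powTwist_le {ι : Type*} [Fintype ι] {v : ι → ℂ} (hv : ∑ x, ‖v x‖ ^ 2 = 1) {z : ℂ}
    (hz : 0 ≤ z.re) (x : ι) : ‖powTwist v z x‖ ≤ 1 := by
  have h1 : ‖v x‖ ≤ 1 := by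
    have := Finset.single_le_sum (f := fun x => ‖v x‖ ^ 2) (fun _ _ => sq_nonneg _)
      (Finset.mem_univ x)
    rw [hv] at this
    exact (sq_le_one_iff₀ (norm_nonneg _)).1 this
  rw [norm_powTwist]
  refine mul_le_one₀ h1 (Real.exp_nonneg _) (Real.exp_le_one_iff.2 ?_)
  exact mul_nonpos_of_nonneg_of_nonpos hz (Real.log_nonpos (norm_nonneg _) h1)

theorem hasDerivAt_powTwist {ι : Type*} (v : ι → ℂ) (z : ℂ) (x : ι) :
    HasDerivAt (fun z => powTwist v z x) (powTwist v z x * (Real.log ‖v x‖ : ℝ)) z := by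
  have := (((hasDerivAt_id z).mul_const ((Real.log ‖v x‖ : ℝ) : ℂ)).cexp).const_mul (v x)
  simpa [powTwist, mul_assoc] using this

@[simp] theorem powTwist_zero {ι : Type*} (v : ι → ℂ) : powTwist v 0 = v := by
  ext; simp [powTwist]

open Complex Complex.HadamardThreeLines in
/-- The entropic uncertainty relation of Maassen and Uffink, in nats. -/
theorem sum_sq_mul_log_add_le {ι : Type*} [Fintype ι] [DecidableEq ι] {W : Matrix ι ι ℂ}
    (hW : Wᴴ * W = 1) {c : ℝ} (hc : 0 < c) (hWc : ∀ x y, ‖W x y‖ ≤ c) {a : ι → ℂ}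
    (ha : ∑ x, ‖a x‖ ^ 2 = 1) :
    ∑ x, ‖a x‖ ^ 2 * Real.log ‖a x‖ + ∑ y, ‖(W *ᵥ a) y‖ ^ 2 * Real.log ‖(W *ᵥ a) y‖ ≤
      Real.log c := by
  set b := W *ᵥ a with hb
  have hb1 : ∑ y, ‖b y‖ ^ 2 = 1 := by rw [hb, sum_sq_norm_mulVec_of_conjTranspose_mul hW, ha]
  have hb' : Wᴴ *ᵥ b = a := by rw [hb, Matrix.mulVec_mulVec, hW, Matrix.one_mulVec]
  have hsb : ∀ v : ι → ℂ, ∀ x, ‖star v x‖ = ‖v x‖ := fun v x => by simp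
  have hsb1 : ∑ y, ‖star b y‖ ^ 2 = 1 := by simpa only [hsb] using hb1
  -- `F 0 = ⟨b, W a⟩ = ‖b‖² = 1`, and the derivative at 0 is the left side of the claim. On `re z =
  -- 0` the twists only change phases; on `re z = 1` they turn moduli into probabilities, leaving an
  -- average of entries of `W`.
  let F : ℂ → ℂ := fun z => ∑ y, powTwist (star b) z y * ∑ x, W y x * powTwist a z x
  have hF' (z : ℂ) := HasDerivAt.fun_sum (u := Finset.univ) fun y _ =>
    (hasDerivAt_powTwist (star b) z y).mul (HasDerivAt.fun_sum (u := Finset.univ) fun x _ =>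
      (hasDerivAt_powTwist a z x).const_mul (W y x))
  have hbound (z : ℂ) : ‖F z‖ ≤ ∑ y, ‖powTwist (star b) z y‖ * ∑ x, ‖W y x‖ * ‖powTwist a z x‖ := by
    refine (norm_sum_le _ _).trans (Finset.sum_le_sum fun y _ => ?_)
    rw [norm_mul]
    refine mul_le_mul_of_nonneg_left ((norm_sum_le _ _).trans_eq ?_) (norm_nonneg _)
    simp
  have hsum (y : ι) : ∑ x, W y x * a x = b y := rfl
  have hsum' (x : ι) : ∑ y, star (b y) * W y x = star (a x) := by
    rw [← hb']
    simp [Matrix.mulVec, dotProduct, mul_comm]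
  have key := re_deriv_le_log_of_threeLines (F := F) hc (fun z => (hF' z).differentiableAt)
    ?_ ?_ ?_ ?_ (hF' 0)
  · refine le_trans (le_of_eq ?_) key
    simp only [powTwist_zero, Finset.sum_add_distrib, hsum, hsb]
    rw [add_comm, Complex.add_re]
    congr 1
    · rw [← Complex.ofReal_re (∑ y, _)]
      congr 1
      push_cast
      refine Finset.sum_congr rfl fun y _ => ?_
      rw [← Complex.conj_mul', Pi.star_apply, RCLike.star_def]
      ring
    · rw [← Complex.ofReal_re (∑ x, _)]
      congr 1
      simp only [Finset.mul_sum]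
      rw [Finset.sum_comm]
      push_cast
      refine Finset.sum_congr rfl fun x _ => ?_
      rw [← Complex.conj_mul', ← RCLike.star_def, ← hsum' x, Finset.sum_mul, Finset.sum_mul]
      refine Finset.sum_congr rfl fun y _ => ?_
      rw [Pi.star_apply]
      ring
  · refine ⟨∑ y : ι, 1 * ∑ x, ‖W y x‖ * 1, ?_⟩
    rintro _ ⟨z, hz, rfl⟩
    refine (hbound z).trans ?_
    gcongr with y _ x _
    · exact norm_powTwist_le hsb1 hz.1 _
    · exact norm_powTwist_le ha hz.1 _
  · intro z hz
    have hz : z.re = 0 := hz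
    have hq : ∑ y, ‖∑ x, W y x * powTwist a z x‖ ^ 2 = 1 := by
      have := sum_sq_norm_mulVec_of_conjTranspose_mul hW (powTwist a z)
      simp only [norm_powTwist_of_re_eq_zero a hz, ha] at this
      exact this
    calc ‖F z‖ ≤ ∑ y, ‖powTwist (star b) z y‖ * ‖∑ x, W y x * powTwist a z x‖ :=
          (norm_sum_le _ _).trans_eq (by simp only [norm_mul])
      -- Both vectors have norm 1, so AM-GM replaces Cauchy–Schwarz.
      _ ≤ ∑ y, (‖b y‖ ^ 2 + ‖∑ x, W y x * powTwist a z x‖ ^ 2) / 2 := by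
          refine Finset.sum_le_sum fun y _ => ?_
          rw [norm_powTwist_of_re_eq_zero _ hz, hsb]
          linarith [two_mul_le_add_sq ‖b y‖ ‖∑ x, W y x * powTwist a z x‖]
      _ = 1 := by rw [← Finset.sum_div, Finset.sum_add_distrib, hb1, hq]; norm_num
  · intro z hz
    have hz : z.re = 1 := hz
    refine (hbound z).trans ?_
    simp only [norm_powTwist_of_re_eq_one _ hz, hsb]
    calc ∑ y, ‖b y‖ ^ 2 * ∑ x, ‖W y x‖ * ‖a x‖ ^ 2
        ≤ ∑ y, ‖b y‖ ^ 2 * ∑ x, c * ‖a x‖ ^ 2 := by gcongr; exact hWc _ _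
      _ = c := by rw [← Finset.sum_mul, ← Finset.mul_sum, hb1, ha, one_mul, mul_one]
  · simp only [F, powTwist_zero, hsum]
    rw [← Complex.ofReal_one, ← hb1]
    simp [Complex.conj_mul']

namespace QuantumDatabase

/-! ### Entropy and the uncertainty relation in bits -/

theorem entropy_eq_sum_negMulLog {ι : Type*} [Fintype ι] (p : ι → ℝ) :
    entropy p = (∑ x, Real.negMulLog (p x)) / Real.log 2 := by
  simp only [entropy, Real.negMulLog, Real.logb, Finset.sum_div, ← Finset.sum_neg_distrib]
  exact Finset.sum_congr rfl fun x _ => by ring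

theorem entropy_comp_of_bijective {ι κ : Type*} [Fintype ι] [Fintype κ] (p : κ → ℝ) {e : ι → κ}
    (he : Function.Bijective e) : entropy (fun x => p (e x)) = entropy p := by
  rw [entropy, entropy, he.sum_comp fun y => p y * Real.logb 2 (p y)]

theorem entropy_uniform {ι : Type*} [Fintype ι] [Nonempty ι] :
    entropy (fun _ : ι => 1 / (Fintype.card ι : ℝ)) = Real.logb 2 (Fintype.card ι) := by
  simp [entropy]

/-- Entropy is concave. -/
theorem sum_mul_entropy_le {ι ρ : Type*} [Fintype ι] [Fintype ρ] {w : ρ → ℝ} (hw : ∀ r, 0 ≤ w r)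
    (hw1 : ∑ r, w r = 1) {q : ρ → ι → ℝ} (hq : ∀ r x, 0 ≤ q r x) :
    ∑ r, w r * entropy (q r) ≤ entropy fun x => ∑ r, w r * q r x := by
  simp only [entropy_eq_sum_negMulLog, mul_div_assoc', ← Finset.sum_div]
  refine div_le_div_of_nonneg_right ?_ (Real.log_nonneg one_le_two)
  simp only [Finset.mul_sum]
  rw [Finset.sum_comm]
  exact Finset.sum_le_sum fun x _ => Real.concaveOn_negMulLog.le_map_sum (t := Finset.univ)
    (fun r _ => hw r) hw1 fun r _ => hq r x

theorem entropyTwo_eq {ι : Type*} [Fintype ι] (v : ι → ℂ) :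
    entropyTwo v = -2 / Real.log 2 * ∑ x, ‖v x‖ ^ 2 * Real.log ‖v x‖ := by
  simp only [entropyTwo, entropy, Real.logb, Real.log_pow, Finset.mul_sum,
    ← Finset.sum_neg_distrib]
  exact Finset.sum_congr rfl fun x _ => by push_cast; ring

/-- The entropic uncertainty relation for a pair of bases related by a Hadamard matrix. -/
theorem IsHadamard.logb_card_le {ι : Type*} [Fintype ι] [DecidableEq ι] {W : Matrix ι ι ℂ}
    (hW : IsHadamard W) {a : ι → ℂ} (ha : ∑ x, ‖a x‖ ^ 2 = 1) :
    Real.logb 2 (Fintype.card ι) ≤ entropyTwo a + entropyTwo (W *ᵥ a) := by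
  have hne : Nonempty ι := by
    by_contra h
    rw [not_nonempty_iff] at h
    simp at ha
  have hcard : (0 : ℝ) < Fintype.card ι := Nat.cast_pos.2 Fintype.card_pos
  have h := sum_sq_mul_log_add_le (Matrix.mem_unitaryGroup_iff'.1 hW.1)
    (c := 1 / Real.sqrt (Fintype.card ι)) (by positivity) (fun x y => (hW.2 x y).le) ha
  rw [one_div, Real.log_inv, Real.log_sqrt hcard.le] at h
  have h2 : 0 < Real.log 2 := Real.log_pos one_lt_two
  rw [entropyTwo_eq, entropyTwo_eq, ← mul_add, Real.logb, div_le_iff₀ h2, mul_right_comm,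
    div_mul_cancel₀ _ h2.ne']
  linarith

/-! ### Tensor products of Hadamard matrices -/

section Tensor

variable {ι : Type*} {k : ℕ}

theorem tensor_mul [Fintype ι] (B C : Fin k → Matrix ι ι ℂ) :
    tensor B * tensor C = tensor fun t => B t * C t := by
  classical
  ext x y
  simp only [tensor, Matrix.mul_apply, Matrix.of_apply, ← Finset.prod_mul_distrib]
  rw [Finset.prod_univ_sum, Fintype.piFinset_univ]

theorem conjTranspose_tensor (B : Fin k → Matrix ι ι ℂ) :
    (tensor B)ᴴ = tensor fun t => (B t)ᴴ := by
  ext x y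
  simp [tensor]

theorem tensor_one [DecidableEq ι] : tensor (fun _ : Fin k => (1 : Matrix ι ι ℂ)) = 1 := by
  ext x y
  simp only [tensor, Matrix.of_apply, Matrix.one_apply, funext_iff]
  rw [Finset.prod_ite_zero]
  simp

theorem tensor_mem_unitaryGroup [Fintype ι] [DecidableEq ι] {B : Fin k → Matrix ι ι ℂ}
    (hB : ∀ t, B t ∈ Matrix.unitaryGroup ι ℂ) :
    tensor B ∈ Matrix.unitaryGroup (Fin k → ι) ℂ := by
  rw [Matrix.mem_unitaryGroup_iff', Matrix.star_eq_conjTranspose, conjTranspose_tensor, tensor_mul]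
  have this (t) : (B t)ᴴ * B t = 1 := Matrix.mem_unitaryGroup_iff'.1 (hB t)
  simp only [this, tensor_one]

theorem IsHadamard.tensor [Fintype ι] [DecidableEq ι] {B : Fin k → Matrix ι ι ℂ}
    (hB : ∀ t, IsHadamard (B t)) : IsHadamard (tensor B) := by
  refine ⟨tensor_mem_unitaryGroup fun t => (hB t).1, fun x y => ?_⟩
  simp only [QuantumDatabase.tensor, Matrix.of_apply, norm_prod, (hB _).2, Finset.prod_const,
    Finset.card_univ, Fintype.card_fin, Fintype.card_pi]
  rw [one_div_pow]
  congr 1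
  push_cast
  rw [eq_comm, Real.sqrt_eq_iff_mul_self_eq (by positivity) (by positivity), ← mul_pow,
    Real.mul_self_sqrt (by positivity)]

end Tensor

/-! ### The entropic bound for pure states and mixtures -/

section Encoding

variable {k m : ℕ} {A : Fin k → Matrix (Fin (2 ^ m)) (Fin (2 ^ m)) ℂ}

theorem card_database (k m : ℕ) : Fintype.card (Database k m) = 2 ^ (k * m) := by
  simp [Database, ← pow_mul, mul_comm]

theorem cyclicTensor_mem_unitaryGroup (hA : ∀ i, A i ∈ Matrix.unitaryGroup (Fin (2 ^ m)) ℂ)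
    (i : Fin k) : cyclicTensor A i ∈ Matrix.unitaryGroup (Database k m) ℂ :=
  tensor_mem_unitaryGroup fun t => hA (i + t)

/-- The factors are `A_{i+t}† A_{j+t}`, and a common cyclic shift keeps distinct indices distinct.
-/
theorem isHadamard_cyclicTensor (hAH : ∀ i j, i ≠ j → IsHadamard ((A i)ᴴ * A j)) {i j : Fin k}
    (hij : i ≠ j) : IsHadamard ((cyclicTensor A i)ᴴ * cyclicTensor A j) := by
  have : NeZero k := ⟨fun h => by subst h; exact i.elim0⟩
  rw [cyclicTensor, cyclicTensor, conjTranspose_tensor, tensor_mul]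
  exact IsHadamard.tensor fun t => hAH _ _ fun h => hij (add_right_cancel h)

/-- The sum over `i` of a function whose pairwise sums are at least `L`. -/
theorem half_card_mul_le_sum {k : ℕ} (hk : 2 ≤ k) {h : Fin k → ℝ} {L : ℝ}
    (hh : ∀ i j, i ≠ j → L ≤ h i + h j) : (k : ℝ) / 2 * L ≤ ∑ i, h i := by
  have : NeZero k := ⟨by omega⟩
  have h1 : ∑ i, h (i + 1) = ∑ i, h i := Equiv.sum_comp (Equiv.addRight (1 : Fin k)) h
  have h2 : ∑ _i : Fin k, L ≤ ∑ i, (h i + h (i + 1)) := by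
    refine Finset.sum_le_sum fun i _ => hh _ _ fun hi => ?_
    have h3 : (1 : Fin k) = 0 := by simpa using hi.symm
    have := congrArg Fin.val h3
    rw [Fin.val_one', Nat.mod_eq_of_lt (by omega)] at this
    simp at this
  rw [Finset.sum_add_distrib, h1] at h2
  simp only [Finset.sum_const, Finset.card_univ, Fintype.card_fin, nsmul_eq_mul] at h2
  linarith

theorem le_sum_entropyTwo_cyclicTensor (hk : 2 ≤ k)
    (hA : ∀ i, A i ∈ Matrix.unitaryGroup (Fin (2 ^ m)) ℂ)
    (hAH : ∀ i j, i ≠ j → IsHadamard ((A i)ᴴ * A j)) {u : Database k m → ℂ}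
    (hu : ∑ x, ‖u x‖ ^ 2 = 1) :
    (k : ℝ) / 2 * Real.logb 2 (Fintype.card (Database k m)) ≤
      ∑ i, entropyTwo ((cyclicTensor A i)ᴴ *ᵥ u) := by
  refine half_card_mul_le_sum hk fun i j hij => ?_
  have hi : cyclicTensor A i * (cyclicTensor A i)ᴴ = 1 :=
    Matrix.mem_unitaryGroup_iff.1 (cyclicTensor_mem_unitaryGroup hA i)
  -- `C_j† C_i` carries `C_i† u` to `C_j† u`.
  have h := (isHadamard_cyclicTensor hAH hij.symm).logb_card_le
    (a := (cyclicTensor A i)ᴴ *ᵥ u) (by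
      rw [sum_sq_norm_mulVec_of_conjTranspose_mul (by simpa using hi), hu])
  rwa [Matrix.mulVec_mulVec, Matrix.mul_assoc, hi, Matrix.mul_one] at h

/-- An entropic bound for unit vectors extends to mixtures. -/
theorem le_sum_entropy_mixture {ι ρ κ : Type*} [Fintype ι] [DecidableEq ι] [Fintype ρ] [Fintype κ]
    {U : κ → Matrix ι ι ℂ} {B : ℝ}
    (hB : ∀ u : ι → ℂ, ∑ x, ‖u x‖ ^ 2 = 1 → B ≤ ∑ i, entropyTwo (U i *ᵥ u))
    (v : ρ → ι → ℂ) (hv : ∑ r, ∑ x, ‖v r x‖ ^ 2 ≠ 0) :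
    B ≤ ∑ i, entropy fun x => (∑ r, ‖(U i *ᵥ v r) x‖ ^ 2) / ∑ r, ∑ x, ‖v r x‖ ^ 2 := by
  set T := ∑ r, ∑ x, ‖v r x‖ ^ 2 with hT
  have hT0 : 0 ≤ T := by positivity
  let N : ρ → ℝ := fun r => ∑ x, ‖v r x‖ ^ 2
  have hN0 (r) : 0 ≤ N r := by positivity
  have hw1 : ∑ r, N r / T = 1 := by rw [← Finset.sum_div]; exact div_self hv
  have hmix (i : κ) (x : ι) : (∑ r, ‖(U i *ᵥ v r) x‖ ^ 2) / T =
      ∑ r, N r / T * (‖(U i *ᵥ v r) x‖ ^ 2 / N r) := by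
    rw [Finset.sum_div]
    refine Finset.sum_congr rfl fun r _ => ?_
    -- A zero vector has weight 0, and division by zero yields 0 on the right.
    by_cases hN : N r = 0
    · have : v r = 0 := by
        ext x
        have := (Finset.sum_eq_zero_iff_of_nonneg fun x _ => sq_nonneg ‖v r x‖).1 hN x
          (Finset.mem_univ x)
        simpa using this
      simp [this]
    · field_simp
  simp only [hmix]
  calc B = ∑ r, N r / T * B := by rw [← Finset.sum_mul, hw1, one_mul]
    _ ≤ ∑ r, N r / T * ∑ i, entropy fun x => ‖(U i *ᵥ v r) x‖ ^ 2 / N r := by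
        refine Finset.sum_le_sum fun r _ => ?_
        rcases (hN0 r).eq_or_lt with hN | hN
        · simp [← hN]
        refine mul_le_mul_of_nonneg_left ?_ (by positivity)
        have hs : (Real.sqrt (N r)) ^ 2 = N r := Real.sq_sqrt (hN0 r)
        have hnorm : ‖((Real.sqrt (N r) : ℝ) : ℂ)⁻¹‖ ^ 2 = (N r)⁻¹ := by
          rw [norm_inv, inv_pow, Complex.norm_real, Real.norm_eq_abs, sq_abs, hs]
        have := hB (((Real.sqrt (N r) : ℝ) : ℂ)⁻¹ • v r) (by
          simp only [Pi.smul_apply, smul_eq_mul, norm_mul, mul_pow, hnorm, ← Finset.mul_sum]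
          exact inv_mul_cancel₀ hN.ne')
        simp only [entropyTwo, Matrix.mulVec_smul, Pi.smul_apply, smul_eq_mul, norm_mul, mul_pow,
          hnorm] at this
        simpa only [inv_mul_eq_div] using this
    _ = ∑ i, ∑ r, N r / T * entropy fun x => ‖(U i *ᵥ v r) x‖ ^ 2 / N r := by
        simp only [Finset.mul_sum]
        exact Finset.sum_comm
    _ ≤ _ := Finset.sum_le_sum fun i _ => sum_mul_entropy_le
        (fun r => div_nonneg (hN0 r) hT0) hw1 fun r x => div_nonneg (sq_nonneg _) (hN0 r)

theorem reorder_bijective (i : Fin k) : Function.Bijective (reorder (m := m) i) := by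
  have : NeZero k := ⟨fun h => by subst h; exact i.elim0⟩
  exact ((Equiv.addLeft i).arrowCongr (Equiv.refl (Fin (2 ^ m)))).symm.bijective

/-! ### Posteriors and information gain -/

theorem mul_encoding_apply (R : Matrix (Database k m) (Database k m) ℂ) (i : Fin k)
    (r d : Database k m) :
    (R * encoding A i) r d = star (((cyclicTensor A i)ᴴ *ᵥ star (R r)) (reorder i d)) := by
  rw [encoding, ← Matrix.mul_assoc, Matrix.mul_apply]
  simp [reorderMatrix, Matrix.mul_apply, Matrix.mulVec, dotProduct, mul_comm]

variable {J : Type*} (R : J → Matrix (Database k m) (Database k m) ℂ)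

theorem povmProb_eq (i : Fin k) (d : Database k m) (j : J) :
    povmProb A R i d j = ∑ r, ‖(R j * encoding A i) r d‖ ^ 2 := by
  rw [povmProb, Matrix.mul_assoc, ← Matrix.conjTranspose_mul, Matrix.mul_apply, Complex.re_sum]
  refine Finset.sum_congr rfl fun r _ => ?_
  rw [Matrix.conjTranspose_apply, RCLike.star_def, Complex.conj_mul', ← Complex.ofReal_pow,
    Complex.ofReal_re]

theorem povmProb_eq_reorder (i : Fin k) (d : Database k m) (j : J) :
    povmProb A R i d j =
      ∑ r, ‖((cyclicTensor A i)ᴴ *ᵥ star (R j r)) (reorder i d)‖ ^ 2 := by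
  simp only [povmProb_eq, mul_encoding_apply, norm_star]

/-- Since `C_i` is unitary, `i` drops out: the outcome alone says nothing about the encoding. -/
theorem sum_povmProb (hA : ∀ i, A i ∈ Matrix.unitaryGroup (Fin (2 ^ m)) ℂ) (i : Fin k) (j : J) :
    ∑ d, povmProb A R i d j = ∑ r, ∑ x, ‖R j r x‖ ^ 2 := by
  have hi : cyclicTensor A i * (cyclicTensor A i)ᴴ = 1 :=
    Matrix.mem_unitaryGroup_iff.1 (cyclicTensor_mem_unitaryGroup hA i)
  simp only [povmProb_eq_reorder]
  rw [(reorder_bijective i).sum_comp fun x =>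
    ∑ r, ‖((cyclicTensor A i)ᴴ *ᵥ star (R j r)) x‖ ^ 2, Finset.sum_comm]
  refine Finset.sum_congr rfl fun r _ => ?_
  rw [sum_sq_norm_mulVec_of_conjTranspose_mul (by simpa using hi)]
  simp

theorem outcomeProb_povmProb (hA : ∀ i, A i ∈ Matrix.unitaryGroup (Fin (2 ^ m)) ℂ) (i : Fin k)
    (j : J) : outcomeProb (povmProb A R) i j =
      (∑ r, ∑ x, ‖R j r x‖ ^ 2) / Fintype.card (Database k m) := by
  simp only [outcomeProb, prior]
  rw [← Finset.sum_mul, sum_povmProb R hA, mul_one_div]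

theorem entropy_posterior_povmProb (hA : ∀ i, A i ∈ Matrix.unitaryGroup (Fin (2 ^ m)) ℂ)
    (i : Fin k) (j : J) : entropy (posterior (povmProb A R) i j) =
      entropy fun x => (∑ r, ‖((cyclicTensor A i)ᴴ *ᵥ star (R j r)) x‖ ^ 2) /
        ∑ r, ∑ x, ‖star (R j r) x‖ ^ 2 := by
  rw [← entropy_comp_of_bijective (fun x =>
    (∑ r, ‖((cyclicTensor A i)ᴴ *ᵥ star (R j r)) x‖ ^ 2) / _) (reorder_bijective i)]
  congr 1
  ext d
  have hc : (Fintype.card (Database k m) : ℝ) ≠ 0 := by simp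
  rw [posterior, outcomeProb_povmProb R hA, prior, mul_one_div, div_div_div_cancel_right₀ hc,
    povmProb_eq_reorder]
  simp

theorem sum_sq_norm_eq_zero_iff {ι κ : Type*} [Fintype ι] [Fintype κ] (M : Matrix ι κ ℂ) :
    ∑ r, ∑ x, ‖M r x‖ ^ 2 = 0 ↔ M = 0 := by
  rw [Finset.sum_eq_zero_iff_of_nonneg fun r _ => by positivity]
  simp [Finset.sum_eq_zero_iff_of_nonneg, ← Matrix.ext_iff]

theorem infoGain_povmProb_le (hk : 2 ≤ k) (hA : ∀ i, A i ∈ Matrix.unitaryGroup (Fin (2 ^ m)) ℂ)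
    (hAH : ∀ i j, i ≠ j → IsHadamard ((A i)ᴴ * A j)) {j : J} (hj : R j ≠ 0) :
    infoGain (povmProb A R) j ≤ 1 / 2 * Real.logb 2 (Fintype.card (Database k m)) := by
  have hk0 : (0 : ℝ) < k := by exact_mod_cast (by omega : 0 < k)
  have h := le_sum_entropy_mixture
    (fun u hu => le_sum_entropyTwo_cyclicTensor hk hA hAH (u := u) hu) (fun r => star (R j r))
    (by simpa using (sum_sq_norm_eq_zero_iff (R j)).not.2 hj)
  simp only [← entropy_posterior_povmProb R hA] at h
  rw [infoGain, show entropy (prior k m) = _ from entropy_uniform]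
  have h2 := mul_le_mul_of_nonneg_left h (one_div_nonneg.2 hk0.le)
  have h3 : 1 / (k : ℝ) * (k / 2 * Real.logb 2 (Fintype.card (Database k m))) =
      1 / 2 * Real.logb 2 (Fintype.card (Database k m)) := by field_simp
  linarith

theorem sum_sq_norm_of_isPOVM {ι : Type*} [Fintype ι] [DecidableEq ι] [Fintype J]
    {R : J → Matrix ι ι ℂ} (hR : IsPOVM R) :
    ∑ j, ∑ r, ∑ x, ‖R j r x‖ ^ 2 = Fintype.card ι := by
  have h := congrArg Matrix.trace hR
  rw [Matrix.trace_sum, Matrix.trace_one] at h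
  rw [← Complex.ofReal_inj]
  push_cast
  rw [← h]
  refine Finset.sum_congr rfl fun j _ => ?_
  rw [Finset.sum_comm]
  simp [Matrix.trace, Matrix.mul_apply, Complex.conj_mul']

theorem expectedInfoGain_povmProb_le [Fintype J] (hk : 2 ≤ k)
    (hA : ∀ i, A i ∈ Matrix.unitaryGroup (Fin (2 ^ m)) ℂ)
    (hAH : ∀ i j, i ≠ j → IsHadamard ((A i)ᴴ * A j)) (hR : IsPOVM R) :
    expectedInfoGain (povmProb A R) ≤ 1 / 2 * Real.logb 2 (Fintype.card (Database k m)) := by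
  have hk0 : (k : ℝ) ≠ 0 := by exact_mod_cast (by omega : k ≠ 0)
  have hc : (Fintype.card (Database k m) : ℝ) ≠ 0 := by simp
  let q : J → ℝ := fun j => (∑ r, ∑ x, ‖R j r x‖ ^ 2) / Fintype.card (Database k m)
  have hq1 : ∑ j, q j = 1 := by
    rw [← Finset.sum_div, sum_sq_norm_of_isPOVM hR, div_self hc]
  -- The weights `q j` are independent of `i`, so the two averages can be exchanged.
  have heq : expectedInfoGain (povmProb A R) = ∑ j, q j * infoGain (povmProb A R) j := by
    simp only [expectedInfoGain, outcomeProb_povmProb R hA, infoGain]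
    rw [Finset.sum_comm, Finset.mul_sum]
    refine Finset.sum_congr rfl fun j _ => ?_
    rw [← Finset.mul_sum, Finset.sum_sub_distrib]
    simp only [Finset.sum_const, Finset.card_univ, Fintype.card_fin, nsmul_eq_mul, q]
    field_simp
  rw [heq, ← one_mul (1 / 2 * Real.logb 2 _), ← congrArg (· * _) hq1]
  rw [Finset.sum_mul]
  refine Finset.sum_le_sum fun j _ => ?_
  by_cases hj : R j = 0
  · simp [q, hj]
  · exact mul_le_mul_of_nonneg_left (infoGain_povmProb_le R hk hA hAH hj) (by positivity)

/-- The measurement operators of a projective measurement: outcome `j` keeps only row `j`. -/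
def rowOperator {ι : Type*} [DecidableEq ι] (M : Matrix ι ι ℂ) (j : ι) : Matrix ι ι ℂ :=
  Matrix.of fun r x => if r = j then M j x else 0

theorem isPOVM_rowOperator {ι : Type*} [Fintype ι] [DecidableEq ι] {M : Matrix ι ι ℂ}
    (hM : M ∈ Matrix.unitaryGroup ι ℂ) : IsPOVM (rowOperator M) := by
  rw [IsPOVM, ← Matrix.mem_unitaryGroup_iff'.1 hM]
  ext x y
  simp [rowOperator, Matrix.mul_apply, Matrix.sum_apply, Matrix.star_eq_conjTranspose, apply_ite]

/-- Rows of a unitary matrix have norm 1, so every projective outcome meets the nonvanishing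
condition for POVMs. -/
theorem rowOperator_ne_zero {ι : Type*} [Fintype ι] [DecidableEq ι] {M : Matrix ι ι ℂ}
    (hM : M ∈ Matrix.unitaryGroup ι ℂ) (j : ι) : rowOperator M j ≠ 0 := by
  intro h
  have h0 (x) : M j x = 0 := by simpa [rowOperator] using congrFun₂ h j x
  have := congrFun₂ (Matrix.mem_unitaryGroup_iff.1 hM) j j
  simp [Matrix.mul_apply, h0] at this

theorem povmProb_rowOperator (M : Matrix (Database k m) (Database k m) ℂ) :
    povmProb A (rowOperator M) = projProb A M := by
  ext i d j
  rw [povmProb_eq, projProb, Finset.sum_eq_single j]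
  · simp [rowOperator, Matrix.mul_apply]
  · intro r _ hr
    simp [rowOperator, Matrix.mul_apply, hr]
  · simp

end Encoding

end QuantumDatabase

theorem mainTheorem3 (k m n : ℕ) (hk : 2 ≤ k) (hn : n = 2 ^ (k * m))
    (A : Fin k → Matrix (Fin (2 ^ m)) (Fin (2 ^ m)) ℂ)
    (hA : ∀ i, A i ∈ Matrix.unitaryGroup (Fin (2 ^ m)) ℂ)
    (hAH : ∀ i j, i ≠ j → QuantumDatabase.IsHadamard ((A i)ᴴ * A j)) :
    -- the entropic bound, for every unit vector
    (∀ u : QuantumDatabase.Database k m → ℂ, ∑ x, ‖u x‖ ^ 2 = 1 →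
      (k : ℝ) / 2 * Real.logb 2 n ≤
        ∑ i, QuantumDatabase.entropyTwo ((QuantumDatabase.cyclicTensor A i)ᴴ *ᵥ u)) ∧
    -- projective measurements: each outcome, and the mean over the outcomes
    (∀ M ∈ Matrix.unitaryGroup (QuantumDatabase.Database k m) ℂ,
      (∀ j, QuantumDatabase.infoGain (QuantumDatabase.projProb A M) j ≤
        1 / 2 * Real.logb 2 n) ∧
      QuantumDatabase.expectedInfoGain (QuantumDatabase.projProb A M) ≤
        1 / 2 * Real.logb 2 n) ∧
    -- generalized measurements: each outcome that can occur, and the mean over the outcomes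
    (∀ (N : ℕ) (R : Fin N → Matrix (QuantumDatabase.Database k m) (QuantumDatabase.Database k m) ℂ),
      QuantumDatabase.IsPOVM R →
      (∀ j, R j ≠ 0 →
        QuantumDatabase.infoGain (QuantumDatabase.povmProb A R) j ≤ 1 / 2 * Real.logb 2 n) ∧
      QuantumDatabase.expectedInfoGain (QuantumDatabase.povmProb A R) ≤
        1 / 2 * Real.logb 2 n) ∧
    1 / 2 * Real.logb 2 n = (k : ℝ) * m / 2 := by
  have hcard : Fintype.card (QuantumDatabase.Database k m) = n := by
    rw [QuantumDatabase.card_database, hn]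
  rw [← hcard]
  refine ⟨fun u hu => QuantumDatabase.le_sum_entropyTwo_cyclicTensor hk hA hAH hu,
    fun M hM => ?_, fun N R hR => ⟨fun j hj => QuantumDatabase.infoGain_povmProb_le R hk hA hAH hj,
      QuantumDatabase.expectedInfoGain_povmProb_le R hk hA hAH hR⟩, ?_⟩
  · rw [← QuantumDatabase.povmProb_rowOperator]
    exact ⟨fun j => QuantumDatabase.infoGain_povmProb_le _ hk hA hAH
        (QuantumDatabase.rowOperator_ne_zero hM j),
      QuantumDatabase.expectedInfoGain_povmProb_le _ hk hA hAH
        (QuantumDatabase.isPOVM_rowOperator hM)⟩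
  · rw [QuantumDatabase.card_database]
    push_cast
    rw [Real.logb_pow, Real.logb_self_eq_one one_lt_two]
    push_cast
    ring
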